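/- **Bit commitment in nonclassical theories without entanglement.** A *state space* is a finite-dimensional real vector space $V$ with a linear functional $u$ (the order unit) and a nonempty compact convex set $\Omega\subset\{u=1\}$ of (normalized) states that spans $V$. An *effect* is a linear functional $a$ with $0\le a\le 1$ on $\Omega$; an *observable* is a finite family of effects with sum $u$. A state $\mu\in\Omega$ is *exposed* if some effect $a$ *distinguishes* it: for $\omega\in\Omega$, $a(\omega)=1$ iff $\omega=\mu$. The *minimal tensor product* of state spaces is the tensor product of the vector spaces, with the product of the order units, and with the convex hull of the product states as its set of states. A *theory without entanglement* consists of all systems generated by minimal tensor products from a finite set of state spaces, at least one of which is not a simplex. Let $A$ be a state space whose $\Omega$ is not a simplex, and let $d$ be the affine dimension of $\Omega$. (1) There are disjoint finite sets $\{\mu^0_i\}_{i\le N_0}$, $\{\mu^1_j\}_{j\le N_1}$ of exposed states of $A$ and probability weights $p^0,p^1$ with $$\omega=\sum_{i=1}^{N_0}p^0_i\mu^0_i=\sum_{j=1}^{N_1}p^1_j\mu^1_j ,\qquad N_0+N_1=d+2 .$$ Here some weights may be zero; there are also such decompositions with all weights strictly positive and $N_0+N_1\le d+2$. (2) Take any state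 with two such decompositions (of any finite sizes), and any choice of distinguishing effects $a^b_i$ of the states $\mu^b_i$ (such effects exist). For $n\ge 0$ consider the following protocol. To commit to $b\in\{0,1\}$, Alice draws $x=(x_1,\dots,x_n)$ independently from $p^b$ and sends Bob the state $\mu^b_{x_1}\otimes\dots\otimes\mu^b_{x_n}$ of $A^{\otimes n}$. To reveal, she announces $(b,x)$; on the $k$-th subsystem Bob measures an observable containing $a^b_{x_k}$, for $k=1,\dots,n$, and he accepts (and outputs $b$) iff he gets the outcomes $a^b_{x_1},\dots,a^b_{x_n}$; otherwise he rejects. Then: (a) The protocol is perfectly sound: if both parties are honest, Bob accepts and outputs the committed bit with probability $1$. (b) In every theory without entanglement that contains $A$ it is perfectly hiding: if Alice is honest then, for every observable on the minimal tensor product of $A^{\otimes n}$ with an ancilla of the theory that Bob holds in any state, the distribution of Bob's outcomes before the reveal is the same for $b=0$ and $b=1$. (c) It is exponentially binding: there is $r\in(0,1)$, depending only on $A$, the decompositions and the effects, such that for every theory without entanglement that contains $A$, every $n$, every system $R$ of the theory that Alice keeps, every state of the minimal tensor product of $A^{\otimes n}$ and $R$ that she prepares, and every two observables on $R$, one for each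 $b$, whose outcome is the string $x$ that she announces in order to reveal $b$, the probabilities $P_0$, $P_1$ that Bob accepts when she reveals $0$, respectively $1$, satisfy $$P_0+P_1\le 1+r^n .$$ -/

import Mathlib

open scoped TensorProduct

universe u

noncomputable section

namespace GPT

/-! ## Auxiliary topological facts -/

/-- In finite dimension the convex hull of a compact set is compact. -/
theorem isCompact_convexHull {E : Type*} [AddCommGroup E] [Module ℝ E] [FiniteDimensional ℝ E]
    [TopologicalSpace E] [ContinuousAdd E] [ContinuousSMul ℝ E] {s : Set E} (hs : IsCompact s) :
    IsCompact (convexHull ℝ s) := by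
  have key : convexHull ℝ s = ⋃ m ∈ Set.Iic (Module.finrank ℝ E + 1),
      (fun q : (Fin m → ℝ) × (Fin m → E) => ∑ i, q.1 i • q.2 i) ''
        (stdSimplex ℝ (Fin m) ×ˢ Set.univ.pi fun _ => s) := by
    apply Set.Subset.antisymm
    · intro x hx
      obtain ⟨ι, _, z, w, hz, hai, hw, hw1, hx⟩ := eq_pos_convex_span_of_mem_convexHull hx
      have e := Fintype.equivFin ι
      have hc : Fintype.card ι ≤ Module.finrank ℝ E + 1 :=
        (AffineIndependent.card_le_finrank_succ hai).trans
          (Nat.succ_le_succ (Submodule.finrank_le _))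
      refine Set.mem_biUnion (x := Fintype.card ι) hc ?_
      refine ⟨(fun i => w (e.symm i), fun i => z (e.symm i)), ⟨⟨fun i => (hw _).le, ?_⟩, ?_⟩, ?_⟩
      · rw [← hw1]; exact Equiv.sum_comp e.symm w
      · intro i _; exact hz ⟨_, rfl⟩
      · rw [← hx]; exact Equiv.sum_comp e.symm fun i => w i • z i
    · refine Set.iUnion₂_subset fun m _ => ?_
      rintro _ ⟨q, ⟨hq, hq'⟩, rfl⟩
      exact (convex_convexHull ℝ s).sum_mem (fun i _ => hq.1 i) hq.2
        fun i _ => subset_convexHull ℝ s (hq' i trivial)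
  rw [key]
  refine (Set.finite_Iic _).isCompact_biUnion fun m _ => ?_
  refine ((isCompact_stdSimplex ℝ (Fin m)).prod (isCompact_univ_pi fun _ => hs)).image ?_
  fun_prop

/-! ## State spaces -/

/-- A finite-dimensional abstract state space, presented by the base of its cone: a
finite-dimensional real vector space `V` with an order-unit functional `unit` and a nonempty compact
convex set `Ω` of normalized states, lying in the hyperplane `unit = 1` and spanning `V`.
The positive cone is the closed generating cone of nonnegative multiples of elements of `Ω`;
`unit` is strictly positive on it. Compactness refers to the unique
Hausdorff vector space topology of `V`, which is Mathlib's `moduleTopology ℝ V`. -/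
structure StateSpace : Type (u + 1) where
  /-- the ambient vector space -/
  V : Type u
  [addCommGroup : AddCommGroup V]
  [module : Module ℝ V]
  [finiteDimensional : FiniteDimensional ℝ V]
  /-- the order unit -/
  unit : Module.Dual ℝ V
  /-- the normalized states -/
  Ω : Set V
  nonempty : Ω.Nonempty
  convex : Convex ℝ Ω
  compact : @IsCompact V (moduleTopology ℝ V) Ω
  unit_eq_one : ∀ ω ∈ Ω, unit ω = 1
  span_eq_top : Submodule.span ℝ Ω = ⊤

attribute [instance] StateSpace.addCommGroup StateSpace.module StateSpace.finiteDimensional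

namespace StateSpace

/-- The affine dimension of the set of normalized states. -/
def affineDim (A : StateSpace.{u}) : ℕ := Module.finrank ℝ (vectorSpan ℝ A.Ω)

/-- The set of normalized states is a simplex: the convex hull of finitely many affinely
independent points. -/
def IsSimplicial (A : StateSpace.{u}) : Prop :=
  ∃ (m : ℕ) (v : Fin m → A.V), AffineIndependent ℝ v ∧ A.Ω = convexHull ℝ (Set.range v)

/-- An effect: a linear functional `a` with `0 ≤ a ≤ unit` in the dual order, that is, with values
in `[0, 1]` on normalized states. -/
def IsEffect (A : StateSpace.{u}) (a : Module.Dual ℝ A.V) : Prop :=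
  ∀ ω ∈ A.Ω, 0 ≤ a ω ∧ a ω ≤ 1

/-- The effect `a` distinguishes `μ`: it has probability one when, and only when, the state
is `μ`. -/
def IsDistinguishing (A : StateSpace.{u}) (a : Module.Dual ℝ A.V) (μ : A.V) : Prop :=
  A.IsEffect a ∧ ∀ ω ∈ A.Ω, a ω = 1 ↔ ω = μ

/-- An exposed state: a normalized state that has a distinguishing effect. -/
def IsExposed (A : StateSpace.{u}) (μ : A.V) : Prop :=
  μ ∈ A.Ω ∧ ∃ a, A.IsDistinguishing a μ

/-- A discrete observable with outcomes in `X`: a family of effects adding up to the order unit. -/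
structure Observable (A : StateSpace.{u}) (X : Type) [Fintype X] where
  /-- the effect of an outcome -/
  effect : X → Module.Dual ℝ A.V
  isEffect : ∀ x, A.IsEffect (effect x)
  sum_eq : ∑ x, effect x = A.unit

/-! ## Minimal tensor products -/

/-- The product functional `a ⊗ b`, with `(a ⊗ b) (α ⊗ β) = a α * b β`. -/
def prodFunctional {A B : StateSpace.{u}} (a : Module.Dual ℝ A.V) (b : Module.Dual ℝ B.V) :
    Module.Dual ℝ (A.V ⊗[ℝ] B.V) :=
  TensorProduct.dualDistrib ℝ A.V B.V (a ⊗ₜ[ℝ] b)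

/-- The product functional `⨂ a i`, with `(⨂ a i) (⨂ α i) = ∏ a i (α i)`. -/
def piFunctional {n : ℕ} {A : Fin n → StateSpace.{u}} (a : ∀ i, Module.Dual ℝ (A i).V) :
    Module.Dual ℝ (⨂[ℝ] i, (A i).V) :=
  PiTensorProduct.dualDistrib (⨂ₜ[ℝ] i, a i)

/-- The minimal (separable) tensor product of two state spaces: the normalized states are the
mixtures of product states. -/
def minTensor (A B : StateSpace.{u}) : StateSpace.{u} where
  V := A.V ⊗[ℝ] B.V
  unit := prodFunctional A.unit B.unit
  Ω := convexHull ℝ (Set.image2 (fun α β => α ⊗ₜ[ℝ] β) A.Ω B.Ω)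
  nonempty := (A.nonempty.image2 B.nonempty).convexHull
  convex := convex_convexHull ℝ _
  compact := by
    let _ : TopologicalSpace A.V := moduleTopology ℝ A.V
    let _ : TopologicalSpace B.V := moduleTopology ℝ B.V
    let _ : TopologicalSpace (A.V ⊗[ℝ] B.V) := moduleTopology ℝ _
    have : IsModuleTopology ℝ A.V := ⟨rfl⟩
    have : IsModuleTopology ℝ B.V := ⟨rfl⟩
    have : IsModuleTopology ℝ (A.V ⊗[ℝ] B.V) := ⟨rfl⟩
    have : ContinuousAdd (A.V ⊗[ℝ] B.V) := IsModuleTopology.toContinuousAdd ℝ _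
    refine isCompact_convexHull ?_
    rw [← Set.image_prod]
    exact (A.compact.prod B.compact).image
      (IsModuleTopology.continuous_bilinear_of_finite_left (TensorProduct.mk ℝ A.V B.V))
  unit_eq_one := by
    intro ω hω
    have hsub : Set.image2 (fun α β => α ⊗ₜ[ℝ] β) A.Ω B.Ω ⊆
        {v | prodFunctional A.unit B.unit v = 1} := by
      rintro _ ⟨α, hα, β, hβ, rfl⟩
      simp [prodFunctional, A.unit_eq_one α hα, B.unit_eq_one β hβ]
    exact convexHull_min hsub (convex_hyperplane (LinearMap.isLinear _) 1) hω
  span_eq_top := by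
    rw [eq_top_iff]
    refine le_trans (le_of_eq ?_) (Submodule.span_mono (subset_convexHull ℝ _))
    have h := Submodule.map₂_span_span ℝ (TensorProduct.mk ℝ A.V B.V) A.Ω B.Ω
    rw [A.span_eq_top, B.span_eq_top, TensorProduct.map₂_mk_top_top_eq_top] at h
    exact h

/-- The minimal (separable) tensor product of a finite family of state spaces: the normalized
states are the mixtures of product states. -/
def piTensor {n : ℕ} (A : Fin n → StateSpace.{u}) : StateSpace.{u} where
  V := ⨂[ℝ] i, (A i).V
  unit := piFunctional fun i => (A i).unit
  Ω := convexHull ℝ ((fun α : ∀ i, (A i).V => ⨂ₜ[ℝ] i, α i) '' Set.univ.pi fun i => (A i).Ω)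
  nonempty := ((Set.univ_pi_nonempty_iff.2 fun i => (A i).nonempty).image _).convexHull
  convex := convex_convexHull ℝ _
  compact := by
    let _ : ∀ i, TopologicalSpace (A i).V := fun i => moduleTopology ℝ (A i).V
    let _ : TopologicalSpace (⨂[ℝ] i, (A i).V) := moduleTopology ℝ _
    have : ∀ i, IsModuleTopology ℝ (A i).V := fun i => ⟨rfl⟩
    have : IsModuleTopology ℝ (⨂[ℝ] i, (A i).V) := ⟨rfl⟩
    have : ContinuousAdd (⨂[ℝ] i, (A i).V) := IsModuleTopology.toContinuousAdd ℝ _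
    refine isCompact_convexHull ?_
    refine (isCompact_univ_pi fun i => (A i).compact).image ?_
    have hb : (fun α : ∀ i, (A i).V => ⨂ₜ[ℝ] i, α i) = fun α : ∀ i, (A i).V =>
        ∑ r : ∀ i, Fin (Module.finrank ℝ (A i).V),
          (∏ i, (Module.finBasis ℝ (A i).V).repr (α i) (r i)) •
            (⨂ₜ[ℝ] i, Module.finBasis ℝ (A i).V (r i)) := by
      funext α
      have h1 : α = fun i => ∑ j, (Module.finBasis ℝ (A i).V).repr (α i) j •
          Module.finBasis ℝ (A i).V j :=
        funext fun i => ((Module.finBasis ℝ (A i).V).sum_repr (α i)).symm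
      conv_lhs => rw [h1]
      rw [MultilinearMap.map_sum]
      exact Finset.sum_congr rfl fun r _ => MultilinearMap.map_smul_univ _ _ _
    rw [hb]
    have hc : ∀ (i) (j : Fin (Module.finrank ℝ (A i).V)), Continuous fun α : ∀ i, (A i).V =>
        (Module.finBasis ℝ (A i).V).repr (α i) j := fun i j =>
      (IsModuleTopology.continuous_of_linearMap ((Module.finBasis ℝ (A i).V).coord j)).comp
        (continuous_apply i)
    refine continuous_finsetSum _ fun r _ => ?_
    have h2 : Continuous fun α : ∀ i, (A i).V =>
        ∏ i, (Module.finBasis ℝ (A i).V).repr (α i) (r i) :=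
      continuous_finsetProd _ fun i _ => hc i (r i)
    have h3 : Continuous fun c : ℝ => c • (⨂ₜ[ℝ] i, Module.finBasis ℝ (A i).V (r i)) :=
      IsModuleTopology.continuous_of_linearMap (LinearMap.toSpanSingleton ℝ (⨂[ℝ] i, (A i).V)
        (⨂ₜ[ℝ] i, Module.finBasis ℝ (A i).V (r i)))
    exact h3.comp h2
  unit_eq_one := by
    intro ω hω
    have hsub : ((fun α : ∀ i, (A i).V => ⨂ₜ[ℝ] i, α i) '' Set.univ.pi fun i => (A i).Ω) ⊆
        {v | piFunctional (fun i => (A i).unit) v = 1} := by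
      rintro _ ⟨α, hα, rfl⟩
      simp only [piFunctional, Set.mem_ofPred_eq, PiTensorProduct.dualDistrib_apply]
      exact Finset.prod_eq_one fun i _ => (A i).unit_eq_one _ (hα i trivial)
    exact convexHull_min hsub (convex_hyperplane (LinearMap.isLinear _) 1) hω
  span_eq_top := by
    rw [eq_top_iff]
    refine le_trans (le_of_eq ?_) (Submodule.span_mono (subset_convexHull ℝ _))
    have h := PiTensorProduct.submodule_span_eq_top (R := ℝ) (M := fun i => (A i).V)
      (γ := fun i => (A i).Ω) (g := fun i j => (j : (A i).V))
      (fun i => by rw [Subtype.range_coe]; exact (A i).span_eq_top)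
    rw [← h]
    congr 1
    ext v
    constructor
    · rintro ⟨j, rfl⟩
      exact ⟨fun i => j i, fun i _ => (j i).2, rfl⟩
    · rintro ⟨α, hα, rfl⟩
      exact ⟨fun i => ⟨α i, hα i trivial⟩, rfl⟩

/-- The minimal tensor product of `n` copies of `A`. -/
def power (A : StateSpace.{u}) (n : ℕ) : StateSpace.{u} := piTensor fun _ : Fin n => A

end StateSpace

/-- A theory without entanglement: it is generated by a finite set of elementary systems, at least
one of them not a simplex. -/
structure Theory : Type (u + 1) where
  /-- the elementary systems -/
  elementary : Set StateSpace.{u}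
  finite_elementary : elementary.Finite
  exists_nonsimplicial : ∃ A ∈ elementary, ¬ A.IsSimplicial

/-- The systems of the theory: the closure of the elementary ones under minimal tensor products. -/
inductive Theory.IsSystem (T : Theory.{u}) : StateSpace.{u} → Prop
  | elementary (A : StateSpace.{u}) (hA : A ∈ T.elementary) : T.IsSystem A
  | minTensor (A B : StateSpace.{u}) (hA : T.IsSystem A) (hB : T.IsSystem B) :
      T.IsSystem (A.minTensor B)
  | piTensor {n : ℕ} (A : Fin n → StateSpace.{u}) (hA : ∀ i, T.IsSystem (A i)) :
      T.IsSystem (StateSpace.piTensor A)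

/-! ## The protocol -/

/-- A state `ω` of `A` with two decompositions, one for each value `b` of a bit, as convex
combinations `ω = ∑ i, p b i • μ b i` of exposed states, such that the two finite sets
`{μ false i}` and `{μ true j}` are disjoint. The set belonging to `b` has `N b` elements. -/
structure DoubleDecomposition (A : StateSpace.{u}) where
  /-- the decomposed state -/
  ω : A.V
  /-- the number of states of each decomposition -/
  N : Bool → ℕ
  /-- the states of each decomposition -/
  μ : ∀ b, Fin (N b) → A.V
  /-- the weights of each decomposition -/
  p : ∀ b, Fin (N b) → ℝ
  exposed : ∀ b i, A.IsExposed (μ b i)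
  injective : ∀ b, Function.Injective (μ b)
  disjoint : ∀ i j, μ false i ≠ μ true j
  p_nonneg : ∀ b i, 0 ≤ p b i
  p_sum : ∀ b, ∑ i, p b i = 1
  sum_eq : ∀ b, ∑ i, p b i • μ b i = ω

/-- The protocol on `A`: a state with two decompositions, and, for each state of the decompositions,
a distinguishing effect that Bob tests for. -/
structure Protocol (A : StateSpace.{u}) extends DoubleDecomposition A where
  /-- Bob's distinguishing effects -/
  test : ∀ b, Fin (N b) → Module.Dual ℝ A.V
  test_distinguishing : ∀ b i, A.IsDistinguishing (test b i) (μ b i)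

namespace Protocol

variable {A : StateSpace.{u}} (P : Protocol A)

/-- The strings that Alice may announce together with the bit `b`. -/
abbrev Word (n : ℕ) (b : Bool) : Type := Fin n → Fin (P.N b)

/-- The probability that honest Alice, who commits to `b`, draws the string `x`. -/
def wordProb {n : ℕ} (b : Bool) (x : P.Word n b) : ℝ := ∏ k, P.p b (x k)

/-- The product state sent by honest Alice to commit to `b` when the string is `x`. -/
def commitState {n : ℕ} (b : Bool) (x : P.Word n b) : (A.power n).V := ⨂ₜ[ℝ] k, P.μ b (x k)

/-- The effect that Bob accepts the announcement `(b, x)`: on the `k`-th subsystem he measures an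
observable containing the distinguishing effect of `μ b (x k)`, for all `k` with that outcome. -/
def accept {n : ℕ} (b : Bool) (x : P.Word n b) : Module.Dual ℝ (A.power n).V :=
  StateSpace.piFunctional (A := fun _ : Fin n => A) fun k => P.test b (x k)

/-- The probability of Bob's final output when he holds `σ` and Alice announces `(b, x)`: he outputs
the bit `b` if he accepts, and `none` (an accusation of cheating) if he rejects. -/
def bobOutput {n : ℕ} (σ : (A.power n).V) (b : Bool) (x : P.Word n b) : Option Bool → ℝ
  | some c => if c = b then P.accept b x σ else 0
  | none => (A.power n).unit σ - P.accept b x σ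

/-- The probability of Bob's final output in an honest run with committed bit `b`. -/
def honestOutput (n : ℕ) (b : Bool) (o : Option Bool) : ℝ :=
  ∑ x : P.Word n b, P.wordProb b x * P.bobOutput (P.commitState b x) b x o

/-- Perfect soundness: if both parties are honest, then with probability one Bob outputs the
committed bit, and with probability zero he outputs anything else. -/
def PerfectlySound : Prop :=
  ∀ (n : ℕ) (b : Bool) (o : Option Bool), P.honestOutput n b o = if o = some b then 1 else 0

/-- The probability of outcome `y` when honest Alice has committed to `b` and, before the bit is
revealed, Bob adjoins an ancilla in state `ρ` and measures the observable `E` on everything. -/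
def bobGuess {n : ℕ} {R : StateSpace.{u}} {X : Type} [Fintype X] (ρ : R.V)
    (E : ((A.power n).minTensor R).Observable X) (b : Bool) (y : X) : ℝ :=
  ∑ x : P.Word n b, P.wordProb b x * E.effect y (P.commitState b x ⊗ₜ[ℝ] ρ)

/-- Perfect hiding in the theory `T`: whatever ancilla and observable of the theory Bob uses before
the bit is revealed, the distribution of his outcomes does not depend on the committed bit. -/
def PerfectlyHiding (T : Theory.{u}) : Prop :=
  ∀ (n : ℕ) (R : StateSpace.{u}), T.IsSystem R → ∀ ρ ∈ R.Ω, ∀ (X : Type) [Fintype X]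
    (E : ((A.power n).minTensor R).Observable X) (y : X),
    P.bobGuess ρ E false y = P.bobGuess ρ E true y

/-- A strategy of dishonest Alice who keeps the system `R`: she prepares an arbitrary joint state of
the `n` subsystems, which she sends to Bob, and `R`; later, to reveal the bit `b`, she measures `R`
by an observable that may depend on `b` and announces `b` together with the outcome. -/
structure AliceStrategy (n : ℕ) (R : StateSpace.{u}) where
  /-- the joint state -/
  state : ((A.power n).minTensor R).V
  state_mem : state ∈ ((A.power n).minTensor R).Ω
  /-- the observable that yields the announced string -/
  measure : ∀ b, R.Observable (P.Word n b)

/-- The probability that Bob accepts when Alice follows the strategy and reveals `b`. -/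
def AliceStrategy.revealProb {P : Protocol A} {n : ℕ} {R : StateSpace.{u}}
    (S : P.AliceStrategy n R) (b : Bool) : ℝ :=
  ∑ x : P.Word n b,
    StateSpace.prodFunctional (A := A.power n) (P.accept b x) ((S.measure b).effect x) S.state

/-- The binding error of the protocol at length `n` is at most `ε` in the theory `T`: whatever system
of the theory Alice keeps and whatever she does, the probabilities that she succeeds in revealing
`false` and in revealing `true` after one and the same commitment add up to at most `1 + ε`. -/
def IsBinding (T : Theory.{u}) (n : ℕ) (ε : ℝ) : Prop :=
  ∀ R : StateSpace.{u}, T.IsSystem R → ∀ S : P.AliceStrategy n R,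
    S.revealProb false + S.revealProb true ≤ 1 + ε

end Protocol

end GPT

end

/-! The exposed states of `A` are abundant: a point of a compact set that is farthest from some centre
is exposed, and when the centre moves off to infinity in the direction opposite to a linear
functional `f`, the farthest point nearly maximizes `f` (`exists_farthest_point`). So a functional
that is nonnegative on all exposed states is nonnegative on `Ω`
(`StateSpace.nonneg_of_forall_isExposed`), and the exposed states span the space. If there were at
most `dim V = d + 1` of them, they would be a basis of `V` whose coordinate functionals are
nonnegative on `Ω`, and `Ω` would be a simplex. Hence there are `d + 2` exposed states, and the
signs of the coefficients in a linear relation among them give the two decompositions (Radon's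
argument).

Hiding holds because both mixtures of product states sent by honest Alice equal `ω ⊗ ⋯ ⊗ ω`.

For binding, all probabilities are linear in the joint state, so that it may be taken to be a
product `α₁ ⊗ ⋯ ⊗ αₙ ⊗ ρ`. If `x` and `y` are the strings announced for the two bits, then Bob
accepts them with probabilities `s = ∏ aₖ(αₖ)` and `t = ∏ bₖ(αₖ)`, where `aₖ` and `bₖ` distinguish
different states. Now `s + t ≤ 1 + s t` for `s, t ∈ [0, 1]`, and `s t = ∏ aₖ(αₖ) bₖ(αₖ) ≤ r ^ n`, where
`r < 1` bounds `a(α) b(α)` over all states `α` and all pairs of tests of the two decompositions;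
it exists by compactness (`StateSpace.exists_mul_le_of_isDistinguishing`). -/

namespace GPT

/-! ### Farthest points of a compact set -/

/-- A point of a compact set `K` at maximal distance from a centre `c` is the strict maximizer of
`⟪y - c, ·⟫` on `K`. Taking `c = x - t • v` with `t` large makes it a near-maximizer of `⟪v, ·⟫`. -/
theorem exists_farthest_point {E : Type*} [NormedAddCommGroup E] [InnerProductSpace ℝ E]
    {K : Set E} (hK : IsCompact K) (v : E) {x : E} (hx : x ∈ K) {ε : ℝ} (hε : 0 < ε) :
    ∃ y ∈ K, inner ℝ v x ≤ inner ℝ v y + ε ∧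
      ∃ w : E, ∀ z ∈ K, z ≠ y → inner ℝ w z < inner ℝ w y := by
  obtain ⟨D, hD⟩ := hK.isBounded.subset_closedBall x
  have hD0 : 0 ≤ D := by simpa using hD hx
  set t : ℝ := (D ^ 2 + 1) / (2 * ε) with ht
  have ht0 : 0 < t := by positivity
  have htε : 2 * t * ε = D ^ 2 + 1 := by rw [ht]; field_simp
  obtain ⟨y, hy, hmax⟩ := hK.exists_isMaxOn ⟨x, hx⟩
    (f := fun z => ‖z - (x - t • v)‖) (by fun_prop)
  have hmax' : ∀ z ∈ K, ‖z - (x - t • v)‖ ^ 2 ≤ ‖y - (x - t • v)‖ ^ 2 := fun z hz => by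
    have h : ‖z - (x - t • v)‖ ≤ ‖y - (x - t • v)‖ := hmax hz
    gcongr
  refine ⟨y, hy, ?_, y - (x - t • v), fun z hz hzy => ?_⟩
  · have h1 := hmax' x hx
    have h2 : ‖y - x‖ ≤ D := by simpa [dist_eq_norm] using hD hy
    have h3 : ‖y - x‖ ^ 2 ≤ D ^ 2 := by gcongr
    rw [show x - (x - t • v) = t • v by abel, show y - (x - t • v) = (y - x) + t • v by abel,
      norm_add_sq_real, real_inner_smul_right, inner_sub_left, real_inner_comm v y,
      real_inner_comm v x] at h1
    nlinarith
  · -- If `⟪y - c, z - y⟫ ≥ 0`, then `‖z - c‖² ≥ ‖y - c‖² + ‖z - y‖²`, so `z` is farther than `y`.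
    have h1 := hmax' z hz
    rw [show z - (x - t • v) = (y - (x - t • v)) + (z - y) by abel, norm_add_sq_real,
      inner_sub_right] at h1
    have h2 : 0 < ‖z - y‖ ^ 2 := by
      have := norm_pos_iff.2 (sub_ne_zero.2 hzy)
      positivity
    linarith

namespace StateSpace

variable (A : StateSpace.{u})

/-! ### Exposed states -/

theorem exists_isMaxOn_dual (f : Module.Dual ℝ A.V) : ∃ μ ∈ A.Ω, ∀ ω ∈ A.Ω, f ω ≤ f μ := by
  let _ : TopologicalSpace A.V := moduleTopology ℝ A.V
  have : IsModuleTopology ℝ A.V := ⟨rfl⟩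
  exact A.compact.exists_isMaxOn A.nonempty
    (IsModuleTopology.continuous_of_linearMap f).continuousOn

variable {A} in
/-- A strict maximizer on `Ω` of a linear functional is exposed: an affine rescaling of the
functional is a distinguishing effect. -/
theorem isExposed_of_forall_lt {g : Module.Dual ℝ A.V} {μ : A.V} (hμ : μ ∈ A.Ω)
    (h : ∀ ω ∈ A.Ω, ω ≠ μ → g ω < g μ) : A.IsExposed μ := by
  obtain ⟨ν, hν, hmin⟩ := A.exists_isMaxOn_dual (-g)
  -- Subtracting one more than the minimum keeps the denominator positive even if `Ω` is a point.
  set m : ℝ := g ν - 1 with hm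
  have hlow : ∀ ω ∈ A.Ω, m < g ω := fun ω hω => by
    have := hmin ω hω
    simp only [LinearMap.neg_apply] at this
    linarith
  have hc : 0 < g μ - m := sub_pos.2 (hlow μ hμ)
  have hle : ∀ ω ∈ A.Ω, g ω ≤ g μ := fun ω hω => by
    by_cases hωμ : ω = μ
    · rw [hωμ]
    · exact (h ω hω hωμ).le
  have hval : ∀ ω ∈ A.Ω, ((g μ - m)⁻¹ • (g - m • A.unit)) ω = (g ω - m) / (g μ - m) := by
    intro ω hω
    simp [A.unit_eq_one ω hω]
    ring
  refine ⟨hμ, (g μ - m)⁻¹ • (g - m • A.unit), fun ω hω => ?_, fun ω hω => ?_⟩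
  · rw [hval ω hω, div_le_one hc]
    exact ⟨div_nonneg (sub_pos.2 (hlow ω hω)).le hc.le, by linarith [hle ω hω]⟩
  · rw [hval ω hω, div_eq_one_iff_eq hc.ne']
    refine ⟨fun heq => ?_, fun heq => by rw [heq]⟩
    by_contra hne
    linarith [h ω hω hne]

/-- A form of Straszewicz's theorem: a linear functional comes arbitrarily close to its supremum
over the states on the exposed states. -/
theorem exists_isExposed_le_add (f : Module.Dual ℝ A.V) {ω : A.V} (hω : ω ∈ A.Ω) {ε : ℝ}
    (hε : 0 < ε) : ∃ μ, A.IsExposed μ ∧ f ω ≤ f μ + ε := by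
  let _ : TopologicalSpace A.V := moduleTopology ℝ A.V
  have : IsModuleTopology ℝ A.V := ⟨rfl⟩
  let e : A.V ≃ₗ[ℝ] EuclideanSpace ℝ (Fin (Module.finrank ℝ A.V)) :=
    (Module.finBasis ℝ A.V).equivFun.trans (WithLp.linearEquiv 2 ℝ _).symm
  have hK : IsCompact (e '' A.Ω) :=
    A.compact.image (IsModuleTopology.continuous_of_linearMap e.toLinearMap)
  let v : EuclideanSpace ℝ (Fin (Module.finrank ℝ A.V)) :=
    (InnerProductSpace.toDual ℝ _).symm (f ∘ₗ e.symm.toLinearMap).toContinuousLinearMap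
  have hv : ∀ z, inner ℝ v (e z) = f z := fun z => by simp [v]
  obtain ⟨_, ⟨μ, hμ, rfl⟩, hle, w, hw⟩ := exists_farthest_point hK v ⟨ω, hω, rfl⟩ hε
  rw [hv, hv] at hle
  refine ⟨μ, isExposed_of_forall_lt (g := (innerₗ _ w) ∘ₗ e.toLinearMap) hμ fun z hz hne => ?_, hle⟩
  simpa using hw (e z) ⟨z, hz, rfl⟩ (e.injective.ne hne)

theorem nonneg_of_forall_isExposed {f : Module.Dual ℝ A.V} (hf : ∀ μ, A.IsExposed μ → 0 ≤ f μ)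
    {ω : A.V} (hω : ω ∈ A.Ω) : 0 ≤ f ω := by
  refine le_of_forall_pos_le_add fun ε hε => ?_
  obtain ⟨μ, hμ, hle⟩ := A.exists_isExposed_le_add (-f) hω hε
  have := hf μ hμ
  simp only [LinearMap.neg_apply] at hle
  linarith

theorem span_isExposed_eq_top : Submodule.span ℝ {μ | A.IsExposed μ} = ⊤ := by
  by_contra hne
  obtain ⟨f, hf0, hf⟩ := Submodule.exists_le_ker_of_lt_top _ (lt_top_iff_ne_top.2 hne)
  have hE : ∀ μ, A.IsExposed μ → f μ = 0 := fun μ hμ => hf (Submodule.subset_span hμ)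
  refine hf0 (LinearMap.ext_on A.span_eq_top fun ω hω => le_antisymm ?_ ?_)
  · have := A.nonneg_of_forall_isExposed (f := -f) (fun μ hμ => by simp [hE μ hμ]) hω
    simpa using this
  · exact A.nonneg_of_forall_isExposed (fun μ hμ => (hE μ hμ).ge) hω

theorem finrank_le_affineDim_add_one : Module.finrank ℝ A.V ≤ A.affineDim + 1 := by
  obtain ⟨ω₀, hω₀⟩ := A.nonempty
  have htop : vectorSpan ℝ A.Ω ⊔ Submodule.span ℝ {ω₀} = ⊤ := by
    rw [eq_top_iff, ← A.span_eq_top, Submodule.span_le]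
    intro ω hω
    rw [← sub_add_cancel ω ω₀]
    exact Submodule.add_mem_sup (vsub_mem_vectorSpan ℝ hω hω₀) (Submodule.mem_span_singleton_self ω₀)
  have h1 := Submodule.finrank_add_le_finrank_add_finrank (vectorSpan ℝ A.Ω)
    (Submodule.span ℝ {ω₀})
  have h2 := finrank_span_le_card (R := ℝ) ({ω₀} : Set A.V)
  rw [htop, finrank_top] at h1
  simp only [Set.toFinset_singleton, Finset.card_singleton] at h2
  exact h1.trans (Nat.add_le_add_left h2 _)

theorem affineDim_add_one_le_finrank : A.affineDim + 1 ≤ Module.finrank ℝ A.V := by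
  obtain ⟨ω₀, hω₀⟩ := A.nonempty
  refine Submodule.finrank_lt (s := vectorSpan ℝ A.Ω) fun htop => ?_
  have hle : vectorSpan ℝ A.Ω ≤ LinearMap.ker A.unit := by
    rw [vectorSpan_def, Submodule.span_le]
    rintro _ ⟨α, hα, β, hβ, rfl⟩
    simp [A.unit_eq_one α hα, A.unit_eq_one β hβ]
  have h0 : A.unit ω₀ = 0 := hle (htop ▸ Submodule.mem_top)
  rw [A.unit_eq_one ω₀ hω₀] at h0
  exact one_ne_zero h0

theorem finrank_eq : Module.finrank ℝ A.V = A.affineDim + 1 :=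
  le_antisymm A.finrank_le_affineDim_add_one A.affineDim_add_one_le_finrank

variable {A}

/-- If the exposed states are linearly independent, the coordinate functionals of the basis that
they form are nonnegative on `Ω` and sum to the unit, so every state is a convex combination of the
exposed ones. -/
theorem isSimplicial_of_linearIndependent {m : ℕ} {v : Fin m → A.V}
    (hv : Set.range v = {μ | A.IsExposed μ}) (hli : LinearIndependent ℝ v) : A.IsSimplicial := by
  have hE : ∀ i, A.IsExposed (v i) := fun i => hv.le ⟨i, rfl⟩
  refine ⟨m, v, hli.affineIndependent, Set.Subset.antisymm (fun ω hω => ?_) ?_⟩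
  · let b := Module.Basis.mk hli (by rw [hv, A.span_isExposed_eq_top])
    have hb : ∀ i, b i = v i := fun i => by simp [b]
    have hsum : ∑ i, b.repr ω i • v i = ω := by
      simpa only [hb] using b.sum_repr ω
    have hone : ∑ i, b.repr ω i = 1 := by
      have h := congrArg A.unit hsum
      simpa [A.unit_eq_one _ (hE _).1, A.unit_eq_one ω hω] using h
    have hnn : ∀ i, 0 ≤ b.repr ω i := fun i => by
      refine A.nonneg_of_forall_isExposed (f := b.coord i) (fun μ hμ => ?_) hω
      obtain ⟨j, rfl⟩ := hv.ge hμ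
      rw [← hb, b.coord_apply, b.repr_self, Finsupp.single_apply]
      split_ifs <;> norm_num
    rw [← hsum]
    exact (convex_convexHull ℝ _).sum_mem (fun i _ => hnn i) hone
      fun i _ => subset_convexHull ℝ _ ⟨i, rfl⟩
  · exact convexHull_min (Set.range_subset_iff.2 fun i => (hE i).1) A.convex

theorem exists_finset_isExposed (hA : ¬ A.IsSimplicial) :
    ∃ t : Finset A.V, t.card = A.affineDim + 2 ∧ ∀ μ ∈ t, A.IsExposed μ := by
  set E : Set A.V := {μ | A.IsExposed μ} with hEdef
  by_cases hfin : E.Finite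
  · have hcard : A.affineDim + 2 ≤ hfin.toFinset.card := by
      by_contra hlt
      refine hA (isSimplicial_of_linearIndependent
        (v := fun i => (hfin.toFinset.equivFin.symm i : A.V)) ?_ ?_)
      · ext μ
        constructor
        · rintro ⟨i, rfl⟩
          exact hfin.mem_toFinset.1 (hfin.toFinset.equivFin.symm i).2
        · intro hμ
          exact ⟨hfin.toFinset.equivFin ⟨μ, hfin.mem_toFinset.2 hμ⟩, by simp⟩
      · have hsub : LinearIndependent ℝ (fun i : hfin.toFinset => (i : A.V)) := by
          refine linearIndependent_of_top_le_span_of_card_le_finrank ?_ ?_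
          · rw [← A.span_isExposed_eq_top]
            exact Submodule.span_mono fun μ hμ => ⟨⟨μ, hfin.mem_toFinset.2 hμ⟩, rfl⟩
          · rw [Fintype.card_coe, A.finrank_eq]
            omega
        exact hsub.comp _ hfin.toFinset.equivFin.symm.injective
    obtain ⟨t, ht, htc⟩ := Finset.exists_subset_card_eq hcard
    exact ⟨t, htc, fun μ hμ => hfin.mem_toFinset.1 (ht hμ)⟩
  · obtain ⟨t, ht, htc⟩ := Set.Infinite.exists_subset_card_eq hfin (A.affineDim + 2)
    exact ⟨t, htc, fun μ hμ => ht hμ⟩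

end StateSpace

/-! ### Double decompositions from linear relations -/

variable {A : StateSpace.{u}}

/-- The double decomposition given by two disjoint finite sets of exposed states and weights on
them. -/
noncomputable def DoubleDecomposition.ofFinsets (S : Bool → Finset A.V) (q : Bool → A.V → ℝ)
    (hE : ∀ b, ∀ μ ∈ S b, A.IsExposed μ) (hS : Disjoint (S false) (S true))
    (hq : ∀ b, ∀ μ ∈ S b, 0 ≤ q b μ) (hq1 : ∀ b, ∑ μ ∈ S b, q b μ = 1)
    (hsum : ∑ μ ∈ S false, q false μ • μ = ∑ μ ∈ S true, q true μ • μ) :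
    DoubleDecomposition A where
  ω := ∑ μ ∈ S false, q false μ • μ
  N b := (S b).card
  μ b i := (S b).equivFin.symm i
  p b i := q b ((S b).equivFin.symm i)
  exposed b i := hE b _ ((S b).equivFin.symm i).2
  injective b := Subtype.val_injective.comp (S b).equivFin.symm.injective
  disjoint i j := Finset.disjoint_iff_ne.1 hS _ ((S false).equivFin.symm i).2 _
    ((S true).equivFin.symm j).2
  p_nonneg b i := hq b _ ((S b).equivFin.symm i).2
  p_sum b := by
    rw [Equiv.sum_comp (S b).equivFin.symm (fun μ => q b μ), Finset.sum_coe_sort (S b) (q b), hq1]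
  sum_eq b := by
    rw [Equiv.sum_comp (S b).equivFin.symm (fun μ => q b μ • (μ : A.V)),
      Finset.sum_coe_sort (S b) fun μ => q b μ • μ]
    cases b
    · rfl
    · exact hsum.symm

/-- Radon's argument: a set `S₁` disjoint from the states of positive coefficient in a linear
relation, and containing those of negative coefficient, carries the second decomposition. -/
theorem exists_doubleDecomposition {t : Finset A.V} (hE : ∀ μ ∈ t, A.IsExposed μ) {w : A.V → ℝ}
    (hw : ∑ μ ∈ t, w μ • μ = 0) (hw0 : ∃ μ ∈ t, w μ ≠ 0) {S₁ : Finset A.V} (hS₁ : S₁ ⊆ t)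
    (hle : ∀ μ ∈ S₁, w μ ≤ 0) (hneg : ∀ μ ∈ t, w μ < 0 → μ ∈ S₁) :
    ∃ D : DoubleDecomposition A, D.N false = (t.filter (0 < w ·)).card ∧ D.N true = S₁.card ∧
      ((∀ μ ∈ S₁, w μ ≠ 0) → ∀ b i, 0 < D.p b i) := by
  classical
  set S₀ := t.filter (0 < w ·) with hS₀
  have hdisj : Disjoint S₀ S₁ := Finset.disjoint_left.2 fun μ h0 h1 =>
    (hle μ h1).not_gt (Finset.mem_filter.1 h0).2
  have hsub : S₀ ∪ S₁ ⊆ t := Finset.union_subset (Finset.filter_subset _ _) hS₁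
  have hzero : ∀ μ ∈ t, μ ∉ S₀ ∪ S₁ → w μ = 0 := fun μ hμ hn => by
    rw [Finset.mem_union, not_or] at hn
    refine le_antisymm (not_lt.1 fun h => hn.1 (Finset.mem_filter.2 ⟨hμ, h⟩))
      (not_lt.1 fun h => hn.2 (hneg μ hμ h))
  have hw1 : ∑ μ ∈ t, w μ = 0 := by
    have h := congrArg A.unit hw
    rw [map_sum, map_zero] at h
    rw [← h]
    exact Finset.sum_congr rfl fun μ hμ => by simp [A.unit_eq_one μ (hE μ hμ).1]
  have hvec : ∑ μ ∈ S₀, w μ • μ + ∑ μ ∈ S₁, w μ • μ = 0 := by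
    rw [← Finset.sum_union hdisj, ← hw]
    exact Finset.sum_subset hsub fun μ hμ hn => by simp [hzero μ hμ hn]
  have hsc : ∑ μ ∈ S₀, w μ + ∑ μ ∈ S₁, w μ = 0 := by
    rw [← Finset.sum_union hdisj, ← hw1]
    exact Finset.sum_subset hsub hzero
  set c := ∑ μ ∈ S₀, w μ with hc
  have hcpos : 0 < c := by
    obtain ⟨μ, hμ, hpos⟩ := Finset.exists_pos_of_sum_zero_of_exists_nonzero w hw1 hw0
    exact Finset.sum_pos (fun ν hν => (Finset.mem_filter.1 hν).2)
      ⟨μ, Finset.mem_filter.2 ⟨hμ, hpos⟩⟩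
  have hs1 : ∑ μ ∈ S₁, w μ = -c := by linarith
  have hv1 : ∑ μ ∈ S₁, w μ • μ = -∑ μ ∈ S₀, w μ • μ := (neg_eq_of_add_eq_zero_right hvec).symm
  refine ⟨DoubleDecomposition.ofFinsets (fun b => if b then S₁ else S₀)
    (fun b μ => if b then -w μ / c else w μ / c) ?_ ?_ ?_ ?_ ?_, rfl, rfl, ?_⟩
  · rintro (_ | _) μ hμ
    · exact hE μ (hsub (Finset.mem_union_left _ hμ))
    · exact hE μ (hS₁ hμ)
  · exact hdisj
  · rintro (_ | _) μ hμ
    · exact div_nonneg (Finset.mem_filter.1 hμ).2.le hcpos.le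
    · exact div_nonneg (neg_nonneg.2 (hle μ hμ)) hcpos.le
  · rintro (_ | _)
    · simp only [Bool.false_eq_true, if_false]
      rw [← Finset.sum_div, ← hc, div_self hcpos.ne']
    · simp only [if_true]
      rw [← Finset.sum_div, Finset.sum_neg_distrib, hs1, neg_neg, div_self hcpos.ne']
  · simp only [Bool.false_eq_true, if_false, if_true, div_eq_inv_mul, mul_smul, neg_smul,
      ← Finset.smul_sum, Finset.sum_neg_distrib, hv1, neg_neg]
  · rintro hne (_ | _) i
    · exact div_pos (Finset.mem_filter.1 (S₀.equivFin.symm i).2).2 hcpos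
    · have hi := (S₁.equivFin.symm i).2
      exact div_pos (neg_pos.2 ((hle _ hi).lt_of_ne (hne _ hi))) hcpos

theorem exists_finset_linear_relation (hA : ¬ A.IsSimplicial) :
    ∃ t : Finset A.V, t.card = A.affineDim + 2 ∧ (∀ μ ∈ t, A.IsExposed μ) ∧
      ∃ w : A.V → ℝ, ∑ μ ∈ t, w μ • μ = 0 ∧ ∃ μ ∈ t, w μ ≠ 0 := by
  obtain ⟨t, htc, hE⟩ := StateSpace.exists_finset_isExposed hA
  refine ⟨t, htc, hE, Module.exists_nontrivial_relation_of_finrank_lt_card ?_⟩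
  rw [htc, A.finrank_eq]
  omega

theorem exists_doubleDecomposition_card_eq (hA : ¬ A.IsSimplicial) :
    ∃ D : DoubleDecomposition A, D.N false + D.N true = A.affineDim + 2 := by
  obtain ⟨t, htc, hE, w, hw, hw0⟩ := exists_finset_linear_relation hA
  obtain ⟨D, h0, h1, -⟩ := exists_doubleDecomposition hE hw hw0
    (S₁ := t.filter (¬ 0 < w ·)) (Finset.filter_subset _ _)
    (fun μ hμ => not_lt.1 (Finset.mem_filter.1 hμ).2)
    (fun μ hμ h => Finset.mem_filter.2 ⟨hμ, h.not_gt⟩)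
  exact ⟨D, by rw [h0, h1, Finset.card_filter_add_card_filter_not, htc]⟩

theorem exists_doubleDecomposition_pos (hA : ¬ A.IsSimplicial) :
    ∃ D : DoubleDecomposition A,
      (∀ b i, 0 < D.p b i) ∧ D.N false + D.N true ≤ A.affineDim + 2 := by
  obtain ⟨t, htc, hE, w, hw, hw0⟩ := exists_finset_linear_relation hA
  obtain ⟨D, h0, h1, hpos⟩ := exists_doubleDecomposition hE hw hw0
    (S₁ := t.filter (w · < 0)) (Finset.filter_subset _ _)
    (fun μ hμ => (Finset.mem_filter.1 hμ).2.le)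
    (fun μ hμ h => Finset.mem_filter.2 ⟨hμ, h⟩)
  refine ⟨D, hpos fun μ hμ => (Finset.mem_filter.1 hμ).2.ne, ?_⟩
  rw [h0, h1, ← htc, ← Finset.card_filter_add_card_filter_not (s := t) (0 < w ·)]
  exact Nat.add_le_add_left (Finset.card_le_card
    (Finset.monotone_filter_right t fun μ _ h => not_lt.2 (le_of_lt h))) _

theorem DoubleDecomposition.exists_protocol (D : DoubleDecomposition A) :
    ∃ P : Protocol A, P.toDoubleDecomposition = D := by
  choose a ha using fun b i => (D.exposed b i).2
  exact ⟨{ D with test := a, test_distinguishing := ha }, rfl⟩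

/-! ### Bounds on minimal tensor products -/

namespace StateSpace

theorem sum_dual_apply {X : Type*} [Fintype X] (f : X → Module.Dual ℝ A.V) (v : A.V) :
    (∑ x, f x) v = ∑ x, f x v :=
  LinearMap.sum_apply _ _ _

theorem prodFunctional_tmul {A B : StateSpace.{u}} (a : Module.Dual ℝ A.V)
    (b : Module.Dual ℝ B.V) (α : A.V) (β : B.V) :
    prodFunctional a b (α ⊗ₜ[ℝ] β) = a α * b β := by
  simp [prodFunctional]

theorem piFunctional_tprod {n : ℕ} {A : Fin n → StateSpace.{u}}
    (a : ∀ i, Module.Dual ℝ (A i).V) (α : ∀ i, (A i).V) :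
    piFunctional a (⨂ₜ[ℝ] i, α i) = ∏ i, a i (α i) :=
  PiTensorProduct.dualDistrib_apply a α

/-- A linear functional on `A^{⊗ n} ⊗ R` is bounded on the states by its values on product
states. -/
theorem le_of_forall_tprod_tmul_le {n : ℕ} {R : StateSpace.{u}}
    (L : Module.Dual ℝ ((A.power n).minTensor R).V) {c : ℝ}
    (h : ∀ α : Fin n → A.V, (∀ k, α k ∈ A.Ω) → ∀ ρ ∈ R.Ω, L ((⨂ₜ[ℝ] k, α k) ⊗ₜ[ℝ] ρ) ≤ c)
    {σ : ((A.power n).minTensor R).V} (hσ : σ ∈ ((A.power n).minTensor R).Ω) : L σ ≤ c := by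
  refine convexHull_min (t := {v | L v ≤ c}) ?_ (convex_halfSpace_le L.isLinear c) hσ
  rintro _ ⟨α, hα, ρ, hρ, rfl⟩
  refine convexHull_min (t := {v | (L ∘ₗ (TensorProduct.mk ℝ (A.power n).V R.V).flip ρ) v ≤ c})
    ?_ (convex_halfSpace_le (LinearMap.isLinear _) c) hα
  rintro _ ⟨α, hα, rfl⟩
  exact h α (fun k => hα k trivial) ρ hρ

theorem IsDistinguishing.mul_lt_one {a b : Module.Dual ℝ A.V} {μ ν : A.V}
    (ha : A.IsDistinguishing a μ) (hb : A.IsDistinguishing b ν) (hne : μ ≠ ν) {α : A.V}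
    (hα : α ∈ A.Ω) : a α * b α < 1 := by
  obtain ⟨ha0, ha1⟩ := ha.1 α hα
  obtain ⟨hb0, hb1⟩ := hb.1 α hα
  refine lt_of_le_of_ne (mul_le_one₀ ha1 hb0 hb1) fun h => hne ?_
  have h1 : a α = 1 := by nlinarith
  have h2 : b α = 1 := by nlinarith
  rw [← (ha.2 α hα).1 h1, ← (hb.2 α hα).1 h2]

/-- Effects that distinguish different states cannot both be nearly certain in one state. -/
theorem exists_mul_le_of_isDistinguishing {a b : Module.Dual ℝ A.V} {μ ν : A.V}
    (ha : A.IsDistinguishing a μ) (hb : A.IsDistinguishing b ν) (hne : μ ≠ ν) :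
    ∃ r < (1 : ℝ), ∀ α ∈ A.Ω, a α * b α ≤ r := by
  let _ : TopologicalSpace A.V := moduleTopology ℝ A.V
  have : IsModuleTopology ℝ A.V := ⟨rfl⟩
  obtain ⟨β, hβ, hmax⟩ := A.compact.exists_isMaxOn A.nonempty
    (f := fun α => a α * b α) ((IsModuleTopology.continuous_of_linearMap a).mul
      (IsModuleTopology.continuous_of_linearMap b)).continuousOn
  exact ⟨a β * b β, ha.mul_lt_one hb hne hβ, fun α hα => hmax hα⟩

end StateSpace

namespace Protocol

variable (P : Protocol A)

/-! ### Soundness and hiding -/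

theorem sum_wordProb (n : ℕ) (b : Bool) : ∑ x : P.Word n b, P.wordProb b x = 1 := by
  simp only [wordProb]
  rw [← Fintype.piFinset_univ, ← Finset.prod_univ_sum]
  simp [P.p_sum b]

theorem accept_commitState {n : ℕ} (b : Bool) (x : P.Word n b) :
    P.accept b x (P.commitState b x) = 1 := by
  refine (StateSpace.piFunctional_tprod (A := fun _ : Fin n => A) _ _).trans ?_
  exact Finset.prod_eq_one fun k _ =>
    ((P.test_distinguishing b (x k)).2 _ (P.exposed b (x k)).1).2 rfl

theorem unit_commitState {n : ℕ} (b : Bool) (x : P.Word n b) :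
    (A.power n).unit (P.commitState b x) = 1 := by
  refine (StateSpace.piFunctional_tprod (A := fun _ : Fin n => A) _ _).trans ?_
  exact Finset.prod_eq_one fun k _ => A.unit_eq_one _ (P.exposed b (x k)).1

theorem perfectlySound : P.PerfectlySound := by
  intro n b o
  rcases o with _ | c
  · simp [honestOutput, bobOutput, accept_commitState, unit_commitState]
  · by_cases hc : c = b
    · simp [honestOutput, bobOutput, accept_commitState, sum_wordProb, hc]
    · simp [honestOutput, bobOutput, hc]

/-- Averaged over Alice's random string, the state that she sends is `ω ⊗ ⋯ ⊗ ω`. -/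
theorem sum_wordProb_smul_commitState (n : ℕ) (b : Bool) :
    ∑ x : P.Word n b, P.wordProb b x • P.commitState b x =
      (⨂ₜ[ℝ] _k : Fin n, P.ω : ⨂[ℝ] _k : Fin n, A.V) := by
  have h : (fun _ : Fin n => P.ω) = fun _ => ∑ i, P.p b i • P.μ b i := by rw [P.sum_eq b]
  have hx : ∀ x : P.Word n b, (⨂ₜ[ℝ] k, P.p b (x k) • P.μ b (x k)) =
      (∏ k, P.p b (x k)) • (⨂ₜ[ℝ] k, P.μ b (x k) : ⨂[ℝ] _k : Fin n, A.V) := fun x =>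
    MultilinearMap.map_smul_univ _ _ _
  rw [h, MultilinearMap.map_sum]
  exact Finset.sum_congr rfl fun x _ => (hx x).symm

theorem perfectlyHiding (T : Theory.{u}) : P.PerfectlyHiding T := by
  intro n R _ ρ _ X _ E y
  have key : ∀ b, P.bobGuess ρ E b y =
      E.effect y ((⨂ₜ[ℝ] _k : Fin n, P.ω : ⨂[ℝ] _k : Fin n, A.V) ⊗ₜ[ℝ] ρ) := fun b => by
    rw [← P.sum_wordProb_smul_commitState n b]
    have h := map_sum ((E.effect y) ∘ₗ (TensorProduct.mk ℝ (A.power n).V R.V).flip ρ)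
      (fun x : P.Word n b => P.wordProb b x • P.commitState b x) Finset.univ
    refine Eq.trans ?_ h.symm
    refine Finset.sum_congr rfl fun x _ => ?_
    rw [map_smul]
    rfl
  rw [key, key]

/-! ### Binding -/

theorem exists_test_mul_test_le :
    ∃ r : ℝ, 0 < r ∧ r < 1 ∧
      ∀ i j, ∀ α ∈ A.Ω, P.test false i α * P.test true j α ≤ r := by
  have h : ∀ᶠ r in nhdsWithin (1 : ℝ) (Set.Iio 1), ∀ i j, ∀ α ∈ A.Ω,
      P.test false i α * P.test true j α ≤ r := by
    refine Filter.eventually_all.2 fun i => Filter.eventually_all.2 fun j => ?_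
    obtain ⟨s, hs, hle⟩ := StateSpace.exists_mul_le_of_isDistinguishing
      (P.test_distinguishing false i) (P.test_distinguishing true j) (P.disjoint i j)
    filter_upwards [Ioo_mem_nhdsLT hs] with r hr α hα
    exact (hle α hα).trans hr.1.le
  obtain ⟨r, ⟨h0, h1⟩, hr⟩ :=
    ((show ∀ᶠ r in nhdsWithin (1 : ℝ) (Set.Iio 1), r ∈ Set.Ioo 0 1 from
      Ioo_mem_nhdsLT one_pos).and h).exists
  exact ⟨r, h0, h1, hr⟩

theorem test_mem {α : A.V} (hα : α ∈ A.Ω) (b : Bool) (i : Fin (P.N b)) :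
    0 ≤ P.test b i α ∧ P.test b i α ≤ 1 :=
  (P.test_distinguishing b i).1 α hα

variable {P} in
theorem accept_add_accept_le {r : ℝ}
    (hr : ∀ i j, ∀ α ∈ A.Ω, P.test false i α * P.test true j α ≤ r) {n : ℕ} {α : Fin n → A.V}
    (hα : ∀ k, α k ∈ A.Ω) (x : P.Word n false) (y : P.Word n true) :
    P.accept false x (⨂ₜ[ℝ] k, α k) + P.accept true y (⨂ₜ[ℝ] k, α k) ≤ 1 + r ^ n := by
  have hs : P.accept false x (⨂ₜ[ℝ] k, α k) = ∏ k, P.test false (x k) (α k) :=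
    StateSpace.piFunctional_tprod (A := fun _ : Fin n => A) _ _
  have ht : P.accept true y (⨂ₜ[ℝ] k, α k) = ∏ k, P.test true (y k) (α k) :=
    StateSpace.piFunctional_tprod (A := fun _ : Fin n => A) _ _
  rw [hs, ht]
  have hs1 : ∏ k, P.test false (x k) (α k) ≤ 1 := Finset.prod_le_one
    (fun k _ => (P.test_mem (hα k) _ _).1) fun k _ => (P.test_mem (hα k) _ _).2
  have ht1 : ∏ k, P.test true (y k) (α k) ≤ 1 := Finset.prod_le_one
    (fun k _ => (P.test_mem (hα k) _ _).1) fun k _ => (P.test_mem (hα k) _ _).2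
  have hst : (∏ k, P.test false (x k) (α k)) * ∏ k, P.test true (y k) (α k) ≤ r ^ n := by
    rw [← Finset.prod_mul_distrib]
    refine (Finset.prod_le_prod (fun k _ => mul_nonneg (P.test_mem (hα k) _ _).1
      (P.test_mem (hα k) _ _).1) fun k _ => hr (x k) (y k) (α k) (hα k)).trans_eq ?_
    simp
  nlinarith [mul_nonneg (sub_nonneg.2 hs1) (sub_nonneg.2 ht1)]

/-- Averaging two payoffs over independent variables. -/
theorem sum_mul_add_sum_mul_le {X Y : Type*} [Fintype X] [Fintype Y] {f m : X → ℝ} {g l : Y → ℝ}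
    {c : ℝ} (hm : ∀ x, 0 ≤ m x) (hl : ∀ y, 0 ≤ l y) (hm1 : ∑ x, m x = 1) (hl1 : ∑ y, l y = 1)
    (h : ∀ x y, f x + g y ≤ c) : ∑ x, f x * m x + ∑ y, g y * l y ≤ c := by
  have h1 : ∀ x, f x + ∑ y, g y * l y ≤ c := fun x => by
    have : ∑ y, g y * l y ≤ ∑ y, (c - f x) * l y := Finset.sum_le_sum fun y _ =>
      mul_le_mul_of_nonneg_right (by linarith [h x y]) (hl y)
    rw [← Finset.mul_sum, hl1, mul_one] at this
    linarith
  have h2 : ∑ x, f x * m x ≤ ∑ x, (c - ∑ y, g y * l y) * m x := Finset.sum_le_sum fun x _ =>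
    mul_le_mul_of_nonneg_right (by linarith [h1 x]) (hm x)
  rw [← Finset.mul_sum, hm1, mul_one] at h2
  linarith

variable {P} in
theorem isBinding {r : ℝ} (hr : ∀ i j, ∀ α ∈ A.Ω, P.test false i α * P.test true j α ≤ r)
    (T : Theory.{u}) (n : ℕ) : P.IsBinding T n (r ^ n) := by
  intro R _ S
  let L : Bool → Module.Dual ℝ ((A.power n).minTensor R).V := fun b =>
    ∑ x : P.Word n b,
      StateSpace.prodFunctional (A := A.power n) (P.accept b x) ((S.measure b).effect x)
  have hL : ∀ b σ, L b σ = ∑ x : P.Word n b,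
      StateSpace.prodFunctional (A := A.power n) (P.accept b x) ((S.measure b).effect x) σ :=
    fun b σ => StateSpace.sum_dual_apply _ σ
  suffices h : (L false + L true) S.state ≤ 1 + r ^ n by
    rw [LinearMap.add_apply, hL, hL] at h
    exact h
  refine StateSpace.le_of_forall_tprod_tmul_le _ (fun α hα ρ hρ => ?_) S.state_mem
  have hval : ∀ b, L b ((⨂ₜ[ℝ] k, α k) ⊗ₜ[ℝ] ρ) =
      ∑ x : P.Word n b, P.accept b x (⨂ₜ[ℝ] k, α k) * (S.measure b).effect x ρ := fun b =>
    (hL b _).trans (Finset.sum_congr rfl fun x _ =>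
      StateSpace.prodFunctional_tmul (A := A.power n) _ _ _ _)
  have hsum : ∀ b, ∑ x : P.Word n b, (S.measure b).effect x ρ = 1 := fun b => by
    rw [← LinearMap.sum_apply, (S.measure b).sum_eq, R.unit_eq_one ρ hρ]
  refine (congrArg₂ (· + ·) (hval false) (hval true)).trans_le ?_
  exact sum_mul_add_sum_mul_le (fun x => ((S.measure false).isEffect x ρ hρ).1)
    (fun y => ((S.measure true).isEffect y ρ hρ).1) (hsum false) (hsum true)
    fun x y => accept_add_accept_le hr hα x y

end Protocol

end GPT

theorem mainTheorem3 (A : GPT.StateSpace.{u}) (hA : ¬ A.IsSimplicial) (d : ℕ)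
    (hd : A.affineDim = d) :
    (∃ D : GPT.DoubleDecomposition A, D.N false + D.N true = d + 2) ∧
    (∃ D : GPT.DoubleDecomposition A,
      (∀ b i, 0 < D.p b i) ∧ D.N false + D.N true ≤ d + 2) ∧
    ∀ D : GPT.DoubleDecomposition A,
      (∃ P : GPT.Protocol A, P.toDoubleDecomposition = D) ∧
      ∀ P : GPT.Protocol A, P.toDoubleDecomposition = D →
        P.PerfectlySound ∧
        ∃ r : ℝ, 0 < r ∧ r < 1 ∧ ∀ T : GPT.Theory.{u}, T.IsSystem A →
          P.PerfectlyHiding T ∧ ∀ n : ℕ, P.IsBinding T n (r ^ n) := by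
  subst hd
  refine ⟨GPT.exists_doubleDecomposition_card_eq hA, GPT.exists_doubleDecomposition_pos hA,
    fun D => ⟨D.exists_protocol, fun P _ => ⟨P.perfectlySound, ?_⟩⟩⟩
  obtain ⟨r, h0, h1, hr⟩ := P.exists_test_mul_test_le
  exact ⟨r, h0, h1, fun T _ => ⟨P.perfectlyHiding T, GPT.Protocol.isBinding hr T⟩⟩
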